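/- Let $\Omega\subset\mathbb{R}^2$ be open and connected, and let $f,g:\Omega\to\mathbb{R}$ be real-analytic, with $f$ not constant. For $x\in\Omega$ let $d_f(x)$ be the first integer $k\ge 1$ for which the $k$-th derivative $D^kf(x)$ is not zero; a point $x\in\Omega$ is called a critical point of $f$ of even order if $d_f(x)$ is even. Assume that $$\{f,g\}:=\nabla^{\perp}f\cdot\nabla g=\partial_1 f\,\partial_2 g-\partial_2 f\,\partial_1 g=0\quad\text{on }\Omega$$ and that the critical points of $f$ of even order are isolated, that is, each of them has a neighborhood containing no other critical point of $f$ of even order. Then there exists a function $F$, defined and continuous on the range $f(\Omega)\subset\mathbb{R}$ of $f$, such that $$g(x)=F(f(x))\quad\text{for all }x\in\Omega.$$ -/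

import Mathlib

open Topology Filter

/-- The Euclidean plane. -/
abbrev Plane : Type := EuclideanSpace ℝ (Fin 2)

/-- The partial derivative `∂ᵢ f` at `x`. -/
noncomputable def partialDeriv (i : Fin 2) (f : Plane → ℝ) (x : Plane) : ℝ :=
  fderiv ℝ f x (EuclideanSpace.single i 1)

/-- The Poisson bracket `{f, g} = ∇^⊥ f · ∇ g`, where `∇^⊥ = (-∂₂, ∂₁)`. -/
noncomputable def poissonBracket (f g : Plane → ℝ) (x : Plane) : ℝ :=
  -(partialDeriv 1 f x) * partialDeriv 0 g x + partialDeriv 0 f x * partialDeriv 1 g x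

/-- The degree `d_f(x)`: the first `k ≥ 1` for which the `k`-th derivative `D^k f (x)` is not zero.
(It is `0` if there is no such `k`, which does not happen for an analytic function that is not
constant on a connected open set containing `x`.) -/
noncomputable def vanishingDegree (f : Plane → ℝ) (x : Plane) : ℕ :=
  sInf {k : ℕ | 1 ≤ k ∧ iteratedFDeriv ℝ k f x ≠ 0}

/-- The critical points of `f` in `Ω` of even order. -/
def evenCriticalPoints (Ω : Set Plane) (f : Plane → ℝ) : Set Plane :=
  {x ∈ Ω | 1 < vanishingDegree f x ∧ Even (vanishingDegree f x)}

/-!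
At a point `x` of odd order `d`, some analytic curve `c` from `x` satisfies `f (c s) = f x + s ^ d`.
Off `s = 0` it runs through regular points of `f`, near which `{f, g} = 0` makes `g` a function of
`f`; by analyticity, `g y = g (c ((f y - f x) ^ (1 / d)))` for all `y` near `x`. Since `d` is odd,
the root is single valued on the whole line, and functions analytic in such roots obey the identity
theorem on intervals; hence the local factorizations continue along the connected set of points of
odd order. This set is dense, and the factor extends continuously to `f '' Ω` because `f` maps a
connected neighbourhood of a point onto an interval.
-/

section OddRoot

variable {d : ℕ}

theorem surjective_pow_of_odd (hd : Odd d) : Function.Surjective fun w : ℝ => w ^ d := by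
  refine (continuous_pow d).surjective (tendsto_pow_atTop hd.pos.ne') ?_
  have hneg : Tendsto (fun w : ℝ => -(-w) ^ d) atBot atBot :=
    tendsto_neg_atTop_atBot.comp ((tendsto_pow_atTop hd.pos.ne').comp tendsto_neg_atBot_atTop)
  simpa only [hd.neg_pow, neg_neg] using hneg

/-- The real `d`-th root for odd `d`, as a homeomorphism of the line; its inverse is `w ↦ w ^ d`. -/
noncomputable def oddRoot (hd : Odd d) : ℝ ≃ₜ ℝ :=
  (hd.strictMono_pow.orderIsoOfSurjective _ (surjective_pow_of_odd hd)).toHomeomorph.symm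

variable (hd : Odd d)

@[simp]
theorem oddRoot_symm_apply (w : ℝ) : (oddRoot hd).symm w = w ^ d := rfl

@[simp]
theorem oddRoot_pow (y : ℝ) : oddRoot hd y ^ d = y := (oddRoot hd).symm_apply_apply y

@[simp]
theorem oddRoot_pow_self (w : ℝ) : oddRoot hd (w ^ d) = w := (oddRoot hd).apply_symm_apply w

theorem oddRoot_mul (a b : ℝ) : oddRoot hd (a * b) = oddRoot hd a * oddRoot hd b :=
  hd.strictMono_pow.injective (by simp only [mul_pow, oddRoot_pow])

@[simp]
theorem oddRoot_eq_zero_iff {y : ℝ} : oddRoot hd y = 0 ↔ y = 0 := by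
  rw [← pow_eq_zero_iff (n := d) hd.pos.ne', oddRoot_pow]

theorem oddRoot_zero : oddRoot hd 0 = 0 := (oddRoot_eq_zero_iff hd).2 rfl

theorem analyticAt_oddRoot {y : ℝ} (hy : y ≠ 0) : AnalyticAt ℝ (oddRoot hd) y := by
  have hderiv : (d : ℝ) * oddRoot hd y ^ (d - 1) ≠ 0 :=
    mul_ne_zero (Nat.cast_ne_zero.2 hd.pos.ne') (pow_ne_zero _ ((oddRoot_eq_zero_iff hd).not.2 hy))
  exact ((oddRoot hd).symm.toOpenPartialHomeomorph.contDiffAt_symm_deriv (n := ⊤) hderiv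
    (Set.mem_univ y) (hasDerivAt_pow d _) (contDiff_fun_id.pow d).contDiffAt).analyticAt

theorem analyticAt_oddRoot_comp_pow {ψ : ℝ → ℝ} (hψ : AnalyticAt ℝ ψ 0) :
    AnalyticAt ℝ (fun w => oddRoot hd (ψ (w ^ d))) 0 := by
  have hzero_pow : (0 : ℝ) ^ d = 0 := zero_pow hd.pos.ne'
  have hpow : Tendsto (fun w : ℝ => w ^ d) (𝓝 0) (𝓝 0) := by
    simpa only [hzero_pow] using (continuous_pow (M := ℝ) d).tendsto 0
  by_cases hψ0 : ∀ᶠ z in 𝓝 0, ψ z = 0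
  · refine (analyticAt_const (v := (0 : ℝ))).congr ?_
    filter_upwards [hpow.eventually hψ0] with w hw
    rw [hw, oddRoot_zero]
  · -- Writing `ψ z = z ^ m * u z` with `u 0 ≠ 0`, the root becomes `w ^ m * oddRoot (u (w ^ d))`.
    obtain ⟨m, u, hu, hu0, hψu⟩ := hψ.exists_eventuallyEq_pow_smul_nonzero_iff.2 hψ0
    have hroot : AnalyticAt ℝ (fun w => oddRoot hd (u (w ^ d))) 0 :=
      AnalyticAt.fun_comp (analyticAt_oddRoot hd (by rwa [hzero_pow]))
        (AnalyticAt.fun_comp (g := u) (by rwa [hzero_pow]) (by fun_prop))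
    refine ((analyticAt_id.pow m).mul hroot).congr ?_
    filter_upwards [hpow.eventually hψu] with w hw
    rw [hw, sub_zero, smul_eq_mul, oddRoot_mul, ← pow_mul, mul_comm d m, pow_mul, oddRoot_pow_self]
    rfl

end OddRoot

theorem map_add_pow_nhds_zero {d : ℕ} (hd : Odd d) (a : ℝ) :
    map (fun w : ℝ => a + w ^ d) (𝓝 0) = 𝓝 a := by
  have hmap := ((oddRoot hd).symm.trans (Homeomorph.addLeft a)).map_nhds_eq 0
  rwa [Homeomorph.trans_apply, oddRoot_symm_apply, zero_pow hd.pos.ne',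
    show Homeomorph.addLeft a 0 = a from add_zero a] at hmap

section OddPuiseux

variable {G : Type*} [NormedAddCommGroup G] [NormedSpace ℝ G]

/-- `h` is odd Puiseux at `a` if near `a` it is an analytic function of `(t - a) ^ (1 / d)` for some
odd `d`; this is stated after the substitution `t = a + w ^ d`. -/
def OddPuiseuxAt (h : ℝ → G) (a : ℝ) : Prop :=
  ∃ d : ℕ, Odd d ∧ AnalyticAt ℝ (fun w => h (a + w ^ d)) 0

namespace OddPuiseuxAt

variable {h k : ℝ → G} {a : ℝ}

theorem of_analyticAt (hh : AnalyticAt ℝ h a) : OddPuiseuxAt h a :=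
  ⟨1, odd_one, AnalyticAt.fun_comp (by simpa using hh) (by fun_prop)⟩

theorem analyticAt_pow_mul {d e : ℕ} (he : Odd e) (hh : AnalyticAt ℝ (fun w => h (a + w ^ d)) 0) :
    AnalyticAt ℝ (fun w => h (a + w ^ (e * d))) 0 := by
  simp only [pow_mul]
  exact AnalyticAt.fun_comp (g := fun w => h (a + w ^ d)) (f := fun w : ℝ => w ^ e)
    (by simpa [he.pos.ne'] using hh) (by fun_prop)

theorem continuousAt (hh : OddPuiseuxAt h a) : ContinuousAt h a := by
  obtain ⟨d, hd, hh⟩ := hh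
  rw [ContinuousAt, ← map_add_pow_nhds_zero hd a, tendsto_map'_iff]
  simpa [ContinuousAt, hd.pos.ne', Function.comp_def] using hh.continuousAt

theorem congr (hh : OddPuiseuxAt h a) (hhk : h =ᶠ[𝓝 a] k) : OddPuiseuxAt k a := by
  obtain ⟨d, hd, hh⟩ := hh
  rw [← map_add_pow_nhds_zero hd a] at hhk
  exact ⟨d, hd, hh.congr hhk⟩

theorem comp_analyticAt {φ : ℝ → ℝ} (hh : OddPuiseuxAt h (φ a)) (hφ : AnalyticAt ℝ φ a) :
    OddPuiseuxAt (fun t => h (φ t)) a := by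
  obtain ⟨d, hd, hh⟩ := hh
  have hincr : AnalyticAt ℝ (fun t => φ (a + t) - φ a) 0 :=
    (AnalyticAt.fun_comp (by simpa using hφ) (by fun_prop)).fun_sub analyticAt_const
  have hcomp := AnalyticAt.fun_comp (g := fun w => h (φ a + w ^ d))
    (f := fun w => oddRoot hd (φ (a + w ^ d) - φ a)) (x := 0)
    (by simpa [hd.pos.ne', oddRoot_zero] using hh) (analyticAt_oddRoot_comp_pow hd hincr)
  exact ⟨d, hd, by simpa using hcomp⟩

theorem eventuallyEq_of_frequently (hh : OddPuiseuxAt h a) (hk : OddPuiseuxAt k a)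
    (hhk : ∃ᶠ t in 𝓝[≠] a, h t = k t) : h =ᶠ[𝓝 a] k := by
  obtain ⟨d, hd, hh⟩ := hh
  obtain ⟨e, he, hk⟩ := hk
  have hed := he.mul hd
  rw [EventuallyEq, ← map_add_pow_nhds_zero hed a]
  refine ((analyticAt_pow_mul he hh).frequently_eq_iff_eventually_eq
    (mul_comm d e ▸ analyticAt_pow_mul hd hk)).1 ?_
  rw [frequently_nhdsWithin_iff, ← map_add_pow_nhds_zero hed a, frequently_map] at hhk
  refine frequently_nhdsWithin_iff.2 (hhk.mono fun w hw => ⟨hw.1, ?_⟩)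
  rintro rfl
  exact hw.2 (by simp [hed.pos.ne'])

theorem eventually [CompleteSpace G] (hh : OddPuiseuxAt h a) :
    ∀ᶠ b in 𝓝 a, OddPuiseuxAt h b := by
  obtain ⟨d, hd, hd_analytic⟩ := id hh
  have hroot : Tendsto (fun b => oddRoot hd (b - a)) (𝓝 a) (𝓝 0) := by
    simpa [Function.comp_def, oddRoot_zero] using
      ((oddRoot hd).continuous.comp (continuous_sub_right a)).tendsto a
  filter_upwards [hroot.eventually hd_analytic.eventually_analyticAt] with b hb
  rcases eq_or_ne b a with rfl | hba
  · exact hh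
  · have hroot_analytic : AnalyticAt ℝ (fun z => oddRoot hd (z - a)) b :=
      AnalyticAt.fun_comp (analyticAt_oddRoot hd (sub_ne_zero.2 hba)) (by fun_prop)
    have hcomp := AnalyticAt.fun_comp (f := fun z => oddRoot hd (z - a)) hb hroot_analytic
    exact of_analyticAt (by simpa only [oddRoot_pow, add_sub_cancel] using hcomp)

end OddPuiseuxAt

/-- `h` is odd Puiseux on the open interval `J` (possibly unbounded): a domain on which odd
Puiseux functions obey the identity theorem. -/
structure OddPuiseuxOn (h : ℝ → G) (J : Set ℝ) : Prop where
  isOpen : IsOpen J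
  isPreconnected : IsPreconnected J
  oddPuiseuxAt : ∀ t ∈ J, OddPuiseuxAt h t

theorem eventuallyEq_of_forall_oddPuiseuxAt {h k : ℝ → G} {S : Set ℝ} {a t : ℝ}
    (hS : IsPreconnected S) (hh : ∀ s ∈ S, OddPuiseuxAt h s) (hk : ∀ s ∈ S, OddPuiseuxAt k s)
    (ha : a ∈ S) (hhk : h =ᶠ[𝓝 a] k) (ht : t ∈ S) : h =ᶠ[𝓝 t] k := by
  refine hS.subset_of_closure_inter_subset (u := {t | h =ᶠ[𝓝 t] k})
    isOpen_setOfPred_eventually_nhds ⟨a, ha, hhk⟩ ?_ ht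
  rintro s ⟨hs, hsS⟩
  by_contra hne
  refine hne ((hh s hsS).eventuallyEq_of_frequently (hk s hsS) ?_)
  rw [frequently_nhdsWithin_iff]
  refine (mem_closure_iff_frequently.1 hs).mono fun r hr => ⟨hr.self_of_nhds, ?_⟩
  rintro rfl
  exact hne hr

namespace OddPuiseuxOn

variable {h k : ℝ → G} {J K : Set ℝ} {a : ℝ}

theorem eqOn_inter (hh : OddPuiseuxOn h J) (hk : OddPuiseuxOn k K) (haJ : a ∈ J) (haK : a ∈ K)
    (hhk : h =ᶠ[𝓝 a] k) : Set.EqOn h k (J ∩ K) := fun _ ht =>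
  (eventuallyEq_of_forall_oddPuiseuxAt
    (hh.isPreconnected.ordConnected.inter hk.isPreconnected.ordConnected).isPreconnected
    (fun s hs => hh.oddPuiseuxAt s hs.1) (fun s hs => hk.oddPuiseuxAt s hs.2)
    ⟨haJ, haK⟩ hhk ht).self_of_nhds

theorem exists_union (hh : OddPuiseuxOn h J) (hk : OddPuiseuxOn k K) (haJ : a ∈ J) (haK : a ∈ K)
    (hhk : h =ᶠ[𝓝 a] k) :
    ∃ H, OddPuiseuxOn H (J ∪ K) ∧ Set.EqOn H h J ∧ Set.EqOn H k K := by
  classical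
  have hJ : Set.EqOn (J.piecewise h k) h J := J.piecewise_eqOn h k
  have hK : Set.EqOn (J.piecewise h k) k K := fun t ht => by
    by_cases htJ : t ∈ J
    · rw [hJ htJ, hh.eqOn_inter hk haJ haK hhk ⟨htJ, ht⟩]
    · exact Set.piecewise_eq_of_notMem _ _ _ htJ
  refine ⟨_, ⟨hh.isOpen.union hk.isOpen, hh.isPreconnected.union a haJ haK hk.isPreconnected, ?_⟩,
    hJ, hK⟩
  rintro t (ht | ht)
  · exact (hh.oddPuiseuxAt t ht).congr (hJ.symm.eventuallyEq_of_mem (hh.isOpen.mem_nhds ht))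
  · exact (hk.oddPuiseuxAt t ht).congr (hK.symm.eventuallyEq_of_mem (hk.isOpen.mem_nhds ht))

end OddPuiseuxOn

theorem OddPuiseuxAt.exists_oddPuiseuxOn [CompleteSpace G] {h : ℝ → G} {a : ℝ}
    (hh : OddPuiseuxAt h a) : ∃ J ∈ 𝓝 a, OddPuiseuxOn h J := by
  obtain ⟨ε, hε, hball⟩ := Metric.eventually_nhds_iff_ball.1 hh.eventually
  exact ⟨Metric.ball a ε, Metric.ball_mem_nhds a hε, Metric.isOpen_ball,
    (convex_ball a ε).isPreconnected, hball⟩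

end OddPuiseux

section FunctionalDependence

variable {E F G K : Type*} [NormedAddCommGroup E] [NormedSpace ℝ E]
  [NormedAddCommGroup F] [NormedSpace ℝ F] [NormedAddCommGroup G] [NormedSpace ℝ G]
  [NormedAddCommGroup K] [NormedSpace ℝ K]

theorem hasFDerivAt_comp_zero_of_ker_fderiv_le {f : E → F} {g : E → G} {h : K → E} {b : K}
    (hf : DifferentiableAt ℝ f (h b)) (hg : DifferentiableAt ℝ g (h b))
    (hh : DifferentiableAt ℝ h b) (hker : (fderiv ℝ f (h b)).ker ≤ (fderiv ℝ g (h b)).ker)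
    (hconst : ∀ᶠ b' in 𝓝 b, f (h b') = f (h b)) :
    HasFDerivAt (fun b => g (h b)) (0 : K →L[ℝ] G) b := by
  have hfh : (fderiv ℝ f (h b)).comp (fderiv ℝ h b) = 0 :=
    (hf.hasFDerivAt.comp b hh.hasFDerivAt).unique
      ((hasFDerivAt_const (f (h b)) b).congr_of_eventuallyEq hconst)
  have hgh : (fderiv ℝ g (h b)).comp (fderiv ℝ h b) = 0 :=
    ContinuousLinearMap.ext fun v => hker (DFunLike.congr_fun hfh v)
  exact hgh ▸ hg.hasFDerivAt.comp b hh.hasFDerivAt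

/-- The differentials of `f` and `g` at `x` are proportional: `df ∧ dg = 0` at `x`. In the plane
this is the vanishing of the Poisson bracket. -/
def FDerivWedgeEqZero (f : E → ℝ) (g : E → G) (x : E) : Prop :=
  ∀ v w, fderiv ℝ f x v • fderiv ℝ g x w = fderiv ℝ f x w • fderiv ℝ g x v

theorem FDerivWedgeEqZero.ker_fderiv_le {f : E → ℝ} {g : E → G} {x : E}
    (hfg : FDerivWedgeEqZero f g x) (hf : fderiv ℝ f x ≠ 0) :
    (fderiv ℝ f x).ker ≤ (fderiv ℝ g x).ker := fun v hv => by
  obtain ⟨w, hw⟩ := DFunLike.ne_iff.1 hf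
  have hv0 : fderiv ℝ f x v = 0 := hv
  have hvw : fderiv ℝ f x w • fderiv ℝ g x v = 0 := by rw [← hfg v w, hv0, zero_smul]
  exact (smul_eq_zero.1 hvw).resolve_left hw

variable [CompleteSpace E] {g : E → G}

theorem eventually_hasFDerivAt_comp_implicitFunction_zero [CompleteSpace F] [CompleteSpace K]
    (φ : ImplicitFunctionData ℝ E F K) (hl : ContDiffAt ℝ 1 φ.leftFun φ.pt)
    (hr : ContDiffAt ℝ 1 φ.rightFun φ.pt) (hg : ∀ᶠ x in 𝓝 φ.pt, DifferentiableAt ℝ g x)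
    (hker : ∀ᶠ x in 𝓝 φ.pt, (fderiv ℝ φ.leftFun x).ker ≤ (fderiv ℝ g x).ker) :
    ∀ᶠ z in 𝓝 (φ.prodFun φ.pt),
      HasFDerivAt (fun b => g (φ.implicitFunction z.1 b)) (0 : K →L[ℝ] G) z.2 := by
  have hΨ : ContDiffAt ℝ 1 φ.implicitFunction.uncurry (φ.prodFun φ.pt) :=
    φ.contDiffAt_implicitFunction hl hr one_ne_zero
  have hΨ_tendsto : Tendsto φ.implicitFunction.uncurry (𝓝 (φ.prodFun φ.pt)) (𝓝 φ.pt) := by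
    have hΨ_pt : φ.implicitFunction.uncurry (φ.prodFun φ.pt) = φ.pt :=
      φ.implicitFunction_apply_image.self_of_nhds
    simpa only [hΨ_pt] using hΨ.continuousAt.tendsto
  filter_upwards [φ.leftFun_implicitFunction.eventually_nhds, hΨ.eventually (by simp),
    hΨ_tendsto.eventually (hl.eventually (by simp)), hΨ_tendsto.eventually hg,
    hΨ_tendsto.eventually hker] with z hleft hΨz hlz hgz hkerz
  refine hasFDerivAt_comp_zero_of_ker_fderiv_le (h := φ.implicitFunction z.1)
    (hlz.differentiableAt one_ne_zero) hgz ?_ hkerz ?_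
  · exact DifferentiableAt.comp (f := fun b => (z.1, b)) z.2 (hΨz.differentiableAt one_ne_zero)
      (by fun_prop)
  · filter_upwards [((Continuous.prodMk_right z.1).tendsto z.2).eventually hleft] with b hb
    exact hb.trans hleft.self_of_nhds.symm

theorem exists_nhds_eq_of_implicitFunctionData [CompleteSpace F] [CompleteSpace K]
    (φ : ImplicitFunctionData ℝ E F K) (hl : ContDiffAt ℝ 1 φ.leftFun φ.pt)
    (hr : ContDiffAt ℝ 1 φ.rightFun φ.pt) (hg : ∀ᶠ x in 𝓝 φ.pt, DifferentiableAt ℝ g x)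
    (hker : ∀ᶠ x in 𝓝 φ.pt, (fderiv ℝ φ.leftFun x).ker ≤ (fderiv ℝ g x).ker) :
    ∃ U ∈ 𝓝 φ.pt, ∀ x ∈ U, ∀ y ∈ U, φ.leftFun x = φ.leftFun y → g x = g y := by
  obtain ⟨ε, hε, hball⟩ := Metric.eventually_nhds_iff_ball.1
    (eventually_hasFDerivAt_comp_implicitFunction_zero φ hl hr hg hker)
  rw [φ.prodFun_apply, ← ball_prod_same] at hball
  have hprod : ∀ᶠ x in 𝓝 φ.pt, φ.leftFun x ∈ Metric.ball (φ.leftFun φ.pt) ε ∧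
      φ.rightFun x ∈ Metric.ball (φ.rightFun φ.pt) ε :=
    (hl.continuousAt.eventually (Metric.ball_mem_nhds _ hε)).and
      (hr.continuousAt.eventually (Metric.ball_mem_nhds _ hε))
  refine ⟨_, φ.implicitFunction_apply_image.and hprod, ?_⟩
  rintro x ⟨hx, hx_left, hx_right⟩ y ⟨hy, -, hy_right⟩ hxy
  have hfiber : ∀ b ∈ Metric.ball (φ.rightFun φ.pt) ε,
      HasFDerivAt (fun b => g (φ.implicitFunction (φ.leftFun x) b)) (0 : K →L[ℝ] G) b :=
    fun b hb => hball (φ.leftFun x, b) ⟨hx_left, hb⟩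
  have hconst : g (φ.implicitFunction (φ.leftFun x) (φ.rightFun x)) =
      g (φ.implicitFunction (φ.leftFun x) (φ.rightFun y)) :=
    Metric.isOpen_ball.is_const_of_fderiv_eq_zero (convex_ball _ ε).isPreconnected
      (fun b hb => (hfiber b hb).differentiableAt.differentiableWithinAt)
      (fun b hb => (hfiber b hb).fderiv) hx_right hy_right
  rwa [hx, hxy, hy] at hconst

theorem exists_nhds_eq_of_ker_fderiv_le [FiniteDimensional ℝ F] {f : E → F} {q : E}
    (hf : ContDiffAt ℝ 1 f q) (hf_surj : (fderiv ℝ f q).range = ⊤)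
    (hg : ∀ᶠ x in 𝓝 q, DifferentiableAt ℝ g x)
    (hker : ∀ᶠ x in 𝓝 q, (fderiv ℝ f x).ker ≤ (fderiv ℝ g x).ker) :
    ∃ U ∈ 𝓝 q, ∀ x ∈ U, ∀ y ∈ U, f x = f y → g x = g y :=
  have : CompleteSpace F := FiniteDimensional.complete ℝ F
  exists_nhds_eq_of_implicitFunctionData
    ((hf.hasStrictFDerivAt one_ne_zero).implicitFunctionDataOfComplemented f _ hf_surj
      (fderiv ℝ f q).ker_closedComplemented_of_finiteDimensional_range)
    hf ((ContinuousLinearMap.contDiff _).contDiffAt.comp q (contDiffAt_id.sub contDiffAt_const))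
    hg hker

theorem exists_nhds_eq_of_fderivWedgeEqZero {f : E → ℝ} {q : E}
    (hf : ContDiffAt ℝ 1 f q) (hfq : fderiv ℝ f q ≠ 0) (hg : ∀ᶠ x in 𝓝 q, DifferentiableAt ℝ g x)
    (hfg : ∀ᶠ x in 𝓝 q, FDerivWedgeEqZero f g x) :
    ∃ U ∈ 𝓝 q, ∀ x ∈ U, ∀ y ∈ U, f x = f y → g x = g y := by
  have hf_surj : (fderiv ℝ f q).range = ⊤ :=
    LinearMap.range_eq_top.2
      (LinearMap.surjective fun h => hfq (ContinuousLinearMap.coe_injective h))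
  refine exists_nhds_eq_of_ker_fderiv_le hf hf_surj hg ?_
  filter_upwards [hfg, (hf.continuousAt_fderiv one_ne_zero).eventually_ne hfq] with x hx hfx
  exact hx.ker_fderiv_le hfx

end FunctionalDependence

section VanishingOrder

variable {E F : Type*} [NormedAddCommGroup E] [NormedSpace ℝ E]
  [NormedAddCommGroup F] [NormedSpace ℝ F] {f : E → F} {x : E}

theorem iteratedDeriv_comp_line [CompleteSpace F] (hf : AnalyticAt ℝ f x) (v : E) (k : ℕ) :
    iteratedDeriv k (fun t : ℝ => f (x + t • v)) 0 = iteratedFDeriv ℝ k f x fun _ => v := by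
  obtain ⟨p, r, hp⟩ := hf
  have htranslate : HasFPowerSeriesAt (fun z => f (x + z)) p 0 := by
    simpa [add_comm] using hp.hasFPowerSeriesAt.comp_sub (-x)
  let L : ℝ →L[ℝ] E := ContinuousLinearMap.toSpanSingleton ℝ v
  obtain ⟨s, hs⟩ : HasFPowerSeriesAt ((fun z => f (x + z)) ∘ L) (p.compContinuousLinearMap L) 0 :=
    HasFPowerSeriesAt.compContinuousLinearMap (by simpa using htranslate)
  rw [iteratedDeriv_eq_iteratedFDeriv, ← hp.factorial_smul]
  refine (hs.factorial_smul (1 : ℝ) k).symm.trans ?_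
  rw [FormalMultilinearSeries.compContinuousLinearMap_apply]
  simp [L, Function.comp_def]

theorem exists_iteratedFDeriv_diag_ne_zero [CompleteSpace F] (hf : AnalyticAt ℝ f x) {n : ℕ}
    (hn : iteratedFDeriv ℝ n f x ≠ 0) : ∃ v, (iteratedFDeriv ℝ n f x fun _ => v) ≠ 0 := by
  by_contra! hdiag
  obtain ⟨p, r, hp⟩ := hf
  have hp_diag : (fun y => p n fun _ => y) = 0 := by
    ext y
    have hsmul := hp.factorial_smul y n
    rw [hdiag, ← Nat.cast_smul_eq_nsmul ℝ, smul_eq_zero] at hsmul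
    exact hsmul.resolve_left (Nat.cast_ne_zero.2 n.factorial_ne_zero)
  refine hn (ContinuousMultilinearMap.ext fun v => ?_)
  rw [hp.iteratedFDeriv_eq_sum_of_completeSpace, ← (p n).iteratedFDeriv_comp_diagonal x v, hp_diag,
    iteratedFDeriv_zero]
  rfl

theorem eventually_eq_of_iteratedFDeriv_eq_zero [CompleteSpace F] (hf : AnalyticAt ℝ f x)
    (hzero : ∀ k, 1 ≤ k → iteratedFDeriv ℝ k f x = 0) : ∀ᶠ y in 𝓝 x, f y = f x := by
  obtain ⟨p, r, hp⟩ := hf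
  filter_upwards [Metric.eball_mem_nhds x hp.r_pos] with y hy
  have hsum := hp.hasSum_iteratedFDeriv (y := y - x) (by simpa [edist_eq_enorm_sub] using hy)
  rw [add_sub_cancel] at hsum
  refine hsum.unique ?_
  convert hasSum_single 0 fun n hn => ?_ using 1
  · simp
  · simp [hzero n (Nat.one_le_iff_ne_zero.2 hn)]

/-- The least `k ≥ 1` such that the `k`-th derivative of `f` at `x` does not vanish, and `0` if
there is none; `vanishingDegree` over an arbitrary normed space. -/
noncomputable def vanishingOrder (f : E → F) (x : E) : ℕ :=
  sInf {k : ℕ | 1 ≤ k ∧ iteratedFDeriv ℝ k f x ≠ 0}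

theorem iteratedFDeriv_vanishingOrder_ne_zero (h : vanishingOrder f x ≠ 0) :
    iteratedFDeriv ℝ (vanishingOrder f x) f x ≠ 0 :=
  (Nat.sInf_mem (Nat.nonempty_of_pos_sInf (Nat.pos_of_ne_zero h))).2

theorem iteratedFDeriv_eq_zero_of_lt_vanishingOrder {k : ℕ} (hk : 1 ≤ k)
    (hlt : k < vanishingOrder f x) : iteratedFDeriv ℝ k f x = 0 := by
  by_contra hne
  exact Nat.notMem_of_lt_sInf hlt ⟨hk, hne⟩

theorem vanishingOrder_eq_one_of_fderiv_ne_zero (h : fderiv ℝ f x ≠ 0) :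
    vanishingOrder f x = 1 := by
  have hmem : 1 ∈ {k : ℕ | 1 ≤ k ∧ iteratedFDeriv ℝ k f x ≠ 0} :=
    ⟨le_rfl, fun h1 => h (ContinuousLinearMap.ext fun v => by
      rw [← iteratedFDeriv_one_apply fun _ => v, h1]; rfl)⟩
  exact le_antisymm (Nat.sInf_le hmem) (Nat.sInf_mem ⟨1, hmem⟩).1

theorem vanishingOrder_ne_zero [CompleteSpace F] {Ω : Set E} (hΩ : IsPreconnected Ω)
    (hf : AnalyticOnNhd ℝ f Ω) (hf_nonconst : ∃ x ∈ Ω, ∃ y ∈ Ω, f x ≠ f y) (hx : x ∈ Ω) :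
    vanishingOrder f x ≠ 0 := by
  intro h0
  have hzero : ∀ k, 1 ≤ k → iteratedFDeriv ℝ k f x = 0 := fun k hk => by
    by_contra hne
    have hempty := (Nat.sInf_eq_zero.1 h0).resolve_left (by simp)
    exact hempty.subset ⟨hk, hne⟩
  have heq : Set.EqOn f (fun _ => f x) Ω :=
    hf.eqOn_of_preconnected_of_eventuallyEq analyticOnNhd_const hΩ hx
      (eventually_eq_of_iteratedFDeriv_eq_zero (hf x hx) hzero)
  obtain ⟨a, ha, b, hb, hab⟩ := hf_nonconst
  exact hab ((heq ha).trans (heq hb).symm)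

theorem exists_analyticOrderAt_line_eq_vanishingOrder [CompleteSpace F] (hf : AnalyticAt ℝ f x)
    (hd : vanishingOrder f x ≠ 0) :
    ∃ v : E, analyticOrderAt (fun t : ℝ => f (x + t • v) - f x) 0 = vanishingOrder f x := by
  obtain ⟨v, hv⟩ :=
    exists_iteratedFDeriv_diag_ne_zero hf (iteratedFDeriv_vanishingOrder_ne_zero hd)
  have hline : AnalyticAt ℝ (fun t : ℝ => f (x + t • v)) 0 :=
    AnalyticAt.fun_comp (g := f) (by simpa using hf) (by fun_prop)
  have hderiv : ∀ k, 1 ≤ k → iteratedDeriv k (fun t : ℝ => f (x + t • v) - f x) 0 =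
      iteratedFDeriv ℝ k f x fun _ => v := fun k hk => by
    rw [iteratedDeriv_fun_sub hline.contDiffAt contDiffAt_const, iteratedDeriv_comp_line hf,
      iteratedDeriv_const, if_neg (Nat.one_le_iff_ne_zero.1 hk), sub_zero]
  refine ⟨v, (analyticOrderAt_eq_nat_iff_iteratedDeriv_eq_zero
    (hline.fun_sub analyticAt_const)).2 ⟨fun k hk => ?_, ?_⟩⟩
  · rcases Nat.eq_zero_or_pos k with rfl | hk0
    · simp
    · rw [hderiv k hk0, iteratedFDeriv_eq_zero_of_lt_vanishingOrder hk0 hk]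
      rfl
  · rwa [hderiv _ (Nat.one_le_iff_ne_zero.2 hd)]

end VanishingOrder

section OddNormalForm

theorem exists_analyticAt_rightInverse {σ : ℝ → ℝ} {a : ℝ} (hσ : AnalyticAt ℝ σ a)
    (hσ' : deriv σ a ≠ 0) :
    ∃ T : ℝ → ℝ, AnalyticAt ℝ T (σ a) ∧ T (σ a) = a ∧ ∀ᶠ s in 𝓝 (σ a), σ (T s) = s :=
  ⟨hσ.hasStrictDerivAt.localInverse σ (deriv σ a) a hσ', hσ.analyticAt_localInverse hσ',
    (hσ.hasStrictDerivAt.eventually_left_inverse hσ').self_of_nhds,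
    (hσ.hasStrictDerivAt.hasStrictFDerivAt_equiv hσ').eventually_right_inverse⟩

theorem exists_reparametrization_eq_pow {φ : ℝ → ℝ} {d : ℕ} (hd : Odd d) (hφ : AnalyticAt ℝ φ 0)
    (horder : analyticOrderAt φ 0 = d) :
    ∃ T : ℝ → ℝ, AnalyticAt ℝ T 0 ∧ T 0 = 0 ∧ ∀ᶠ s in 𝓝 0, φ (T s) = s ^ d := by
  obtain ⟨u, hu, hu0, hφu⟩ := hφ.analyticOrderAt_eq_natCast.1 horder
  -- `φ t = t ^ d * u t` is the `d`-th power of the local coordinate `σ t = t * oddRoot (u t)`.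
  have hroot : AnalyticAt ℝ (fun t => oddRoot hd (u t)) 0 :=
    AnalyticAt.fun_comp (g := oddRoot hd) (analyticAt_oddRoot hd hu0) hu
  have hσ : AnalyticAt ℝ (fun t => t * oddRoot hd (u t)) 0 := analyticAt_id.fun_mul hroot
  have hσ_deriv : HasDerivAt (fun t => t * oddRoot hd (u t)) (oddRoot hd (u 0)) 0 := by
    simpa using (hasDerivAt_id' (0 : ℝ)).fun_mul hroot.differentiableAt.hasDerivAt
  obtain ⟨T, hT, hT0, hσT⟩ := exists_analyticAt_rightInverse hσ
    (by rw [hσ_deriv.deriv]; exact (oddRoot_eq_zero_iff hd).not.2 hu0)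
  rw [zero_mul] at hT hT0 hσT
  refine ⟨T, hT, hT0, ?_⟩
  have hT_tendsto : Tendsto T (𝓝 0) (𝓝 0) := by simpa only [hT0] using hT.continuousAt.tendsto
  filter_upwards [hσT, hT_tendsto.eventually hφu] with s hs hφs
  calc φ (T s) = (T s * oddRoot hd (u (T s))) ^ d := by
        rw [hφs, sub_zero, smul_eq_mul, mul_pow, oddRoot_pow]
    _ = s ^ d := by rw [hs]

variable {E : Type*} [NormedAddCommGroup E] [NormedSpace ℝ E] {f : E → ℝ} {x : E}

theorem exists_analytic_curve (hf : AnalyticAt ℝ f x) (hd : Odd (vanishingOrder f x)) :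
    ∃ c : ℝ → E, AnalyticAt ℝ c 0 ∧ c 0 = x ∧
      ∀ᶠ s in 𝓝 0, f (c s) = f x + s ^ vanishingOrder f x := by
  obtain ⟨v, hv⟩ := exists_analyticOrderAt_line_eq_vanishingOrder hf hd.pos.ne'
  have hline : AnalyticAt ℝ (fun t : ℝ => f (x + t • v)) 0 :=
    AnalyticAt.fun_comp (g := f) (by simpa using hf) (by fun_prop)
  obtain ⟨T, hT, hT0, hfT⟩ :=
    exists_reparametrization_eq_pow hd (hline.fun_sub analyticAt_const) hv
  exact ⟨fun s => x + T s • v, by fun_prop, by simp [hT0], hfT.mono fun s => sub_eq_iff_eq_add'.1⟩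

theorem nhds_le_map_of_odd_vanishingOrder (hf : AnalyticAt ℝ f x)
    (hd : Odd (vanishingOrder f x)) : 𝓝 (f x) ≤ map f (𝓝 x) := by
  obtain ⟨c, hc, rfl, hfc⟩ := exists_analytic_curve hf hd
  rw [← map_add_pow_nhds_zero hd, ← map_congr hfc]
  exact (map_map (f := 𝓝 0) (m := c) (m' := f)).ge.trans (map_mono hc.continuousAt)

end OddNormalForm

section LocalFactorization

theorem eventually_eq_comp_oddRoot {α β : Type*} [TopologicalSpace α] {f : α → ℝ} {g : α → β}
    {c : ℝ → α} {d : ℕ} (hd : Odd d) {a s : ℝ} (hf : ContinuousAt f (c s)) (hc : ContinuousAt c s)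
    (hfc : ∀ᶠ t in 𝓝 s, f (c t) = a + t ^ d) {U : Set α} (hU : U ∈ 𝓝 (c s))
    (hUfg : ∀ x ∈ U, ∀ y ∈ U, f x = f y → g x = g y) :
    ∀ᶠ y in 𝓝 (c s), g y = g (c (oddRoot hd (f y - a))) := by
  have hroot : Tendsto (fun y => oddRoot hd (f y - a)) (𝓝 (c s)) (𝓝 s) := by
    have hcont : ContinuousAt (fun y => oddRoot hd (f y - a)) (c s) :=
      (oddRoot hd).continuous.continuousAt.comp (hf.sub continuousAt_const)
    simpa [ContinuousAt, hfc.self_of_nhds] using hcont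
  filter_upwards [hU, hroot.eventually hfc, hroot.eventually (hc hU)] with y hy hfy hcy
  exact hUfg y hy _ hcy (by rw [hfy, oddRoot_pow, add_sub_cancel])

variable {E G : Type*} [NormedAddCommGroup E] [NormedSpace ℝ E] [NormedAddCommGroup G]
  [NormedSpace ℝ G] {f : E → ℝ} {g : E → G}

theorem eqOn_comp_of_convex {B : Set E} (hB : Convex ℝ B) (hf : AnalyticOnNhd ℝ f B)
    (hg : AnalyticOnNhd ℝ g B) {F : ℝ → G} (hF : ∀ y ∈ B, OddPuiseuxAt F (f y)) {q : E}
    (hq : q ∈ B) (hgF : ∀ᶠ y in 𝓝 q, g y = F (f y)) : Set.EqOn g (fun y => F (f y)) B := by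
  intro y hy
  let ℓ : ℝ → E := fun t => q + t • (y - q)
  have hℓB : ∀ t ∈ Set.Icc (0 : ℝ) 1, ℓ t ∈ B := fun t ht => hB.add_smul_sub_mem hq hy ht
  have hℓ : ∀ t, AnalyticAt ℝ ℓ t := fun t => by fun_prop
  have hℓ0 : Tendsto ℓ (𝓝 0) (𝓝 q) := by simpa [ContinuousAt, ℓ] using (hℓ 0).continuousAt
  have hsegment := eventuallyEq_of_forall_oddPuiseuxAt (h := fun t => g (ℓ t))
    (k := fun t => F (f (ℓ t))) (isPreconnected_Icc (a := (0 : ℝ)) (b := 1))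
    (fun t ht => .of_analyticAt (.fun_comp (g := g) (hg _ (hℓB t ht)) (hℓ t)))
    (fun t ht => .comp_analyticAt (φ := fun t => f (ℓ t)) (hF _ (hℓB t ht))
      (.fun_comp (g := f) (hf _ (hℓB t ht)) (hℓ t)))
    (Set.left_mem_Icc.2 zero_le_one) (hℓ0.eventually hgF) (Set.right_mem_Icc.2 zero_le_one)
  simpa [ℓ] using hsegment.self_of_nhds

theorem fderiv_ne_zero_of_comp_eventuallyEq_add_pow {c : ℝ → E} {d : ℕ} {a s : ℝ} (hd : d ≠ 0)
    (hs : s ≠ 0) (hf : DifferentiableAt ℝ f (c s)) (hc : DifferentiableAt ℝ c s)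
    (hfc : ∀ᶠ t in 𝓝 s, f (c t) = a + t ^ d) : fderiv ℝ f (c s) ≠ 0 := by
  intro h0
  have hderiv : fderiv ℝ f (c s) (deriv c s) = d * s ^ (d - 1) :=
    (hf.hasFDerivAt.comp_hasDerivAt s hc.hasDerivAt).unique
      (((hasDerivAt_pow d s).const_add a).congr_of_eventuallyEq hfc)
  rw [h0] at hderiv
  exact mul_ne_zero (Nat.cast_ne_zero.2 hd) (pow_ne_zero _ hs) hderiv.symm

theorem exists_oddPuiseuxAt_comp_eq [CompleteSpace E] [CompleteSpace G] {x : E}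
    (hf : AnalyticAt ℝ f x) (hg : AnalyticAt ℝ g x) (hfg : ∀ᶠ y in 𝓝 x, FDerivWedgeEqZero f g y)
    (hd : Odd (vanishingOrder f x)) :
    ∃ F : ℝ → G, OddPuiseuxAt F (f x) ∧ ∀ᶠ y in 𝓝 x, g y = F (f y) := by
  obtain ⟨c, hc, rfl, hfc⟩ := exists_analytic_curve hf hd
  let F : ℝ → G := fun τ => g (c (oddRoot hd (τ - f (c 0))))
  have hF : OddPuiseuxAt F (f (c 0)) :=
    ⟨_, hd, by simpa [F] using AnalyticAt.fun_comp hg hc⟩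
  obtain ⟨ε, hε, hball⟩ := Metric.eventually_nhds_iff_ball.1
    (hf.eventually_analyticAt.and (hg.eventually_analyticAt.and
      ((hf.continuousAt.eventually hF.eventually).and hfg)))
  -- For `s ≠ 0` the point `c s` is regular for `f`, so that `g` is a function of `f` near `c s`.
  obtain ⟨s, ⟨hsB, hcs, hfcs⟩, hs0 : s ≠ 0⟩ :=
    ((((hc.continuousAt.eventually (Metric.ball_mem_nhds _ hε)).and
      (hc.eventually_analyticAt.and hfc.eventually_nhds)).filter_mono
      nhdsWithin_le_nhds).and (eventually_mem_nhdsWithin (a := (0 : ℝ)) (s := {0}ᶜ))).exists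
  have hball_s := eventually_of_mem (Metric.isOpen_ball.mem_nhds hsB) hball
  have hfs := (hball _ hsB).1
  obtain ⟨U, hU, hUfg⟩ := exists_nhds_eq_of_fderivWedgeEqZero hfs.contDiffAt
    (fderiv_ne_zero_of_comp_eventuallyEq_add_pow hd.pos.ne' hs0 hfs.differentiableAt
      hcs.differentiableAt hfcs)
    (hball_s.mono fun y hy => hy.2.1.differentiableAt) (hball_s.mono fun y hy => hy.2.2.2)
  have hgF : Set.EqOn g (fun y => F (f y)) (Metric.ball (c 0) ε) :=
    eqOn_comp_of_convex (convex_ball _ ε) (fun y hy => (hball y hy).1)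
      (fun y hy => (hball y hy).2.1) (fun y hy => (hball y hy).2.2.1) hsB
      (eventually_eq_comp_oddRoot hd hfs.continuousAt hcs.continuousAt hfcs hU hUfg)
  exact ⟨F, hF, hgF.eventuallyEq_of_mem (Metric.ball_mem_nhds _ hε)⟩

end LocalFactorization

section Continuation

theorem eventuallyEq_of_comp_eventuallyEq {α β γ : Type*} [TopologicalSpace α] [TopologicalSpace β]
    {f : α → β} {g : α → γ} {F H : β → γ} {x : α} (hopen : 𝓝 (f x) ≤ map f (𝓝 x))
    (hF : ∀ᶠ z in 𝓝 x, g z = F (f z)) (hH : ∀ᶠ z in 𝓝 x, g z = H (f z)) : F =ᶠ[𝓝 (f x)] H :=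
  hopen (mem_map.2 (hF.mp (hH.mono fun _ hzH hzF => hzF.symm.trans hzH)))

variable {α G : Type*} [TopologicalSpace α] [NormedAddCommGroup G] [NormedSpace ℝ G]
  {f : α → ℝ} {g : α → G} {X : Set α} {x y : α}

/-- One odd Puiseux function, on one interval, expresses `g` through `f` both near `x` and near `y`.
Being a relation between points, it lets analytic continuation along a connected set be
phrased as transitivity. -/
def CommonOddPuiseuxFactor (f : α → ℝ) (g : α → G) (x y : α) : Prop :=
  ∃ J F, OddPuiseuxOn F J ∧ ∀ᶠ z in 𝓝 x ⊔ 𝓝 y, f z ∈ J ∧ g z = F (f z)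

namespace CommonOddPuiseuxFactor

theorem symm (h : CommonOddPuiseuxFactor f g x y) : CommonOddPuiseuxFactor f g y x := by
  rwa [CommonOddPuiseuxFactor, sup_comm]

theorem trans {z : α} (hopen : 𝓝 (f y) ≤ map f (𝓝 y)) (hxy : CommonOddPuiseuxFactor f g x y)
    (hyz : CommonOddPuiseuxFactor f g y z) : CommonOddPuiseuxFactor f g x z := by
  obtain ⟨J, F, hF, hgF⟩ := hxy
  obtain ⟨K, H, hH, hgH⟩ := hyz
  rw [eventually_sup] at hgF hgH
  obtain ⟨Φ, hΦ, hΦF, hΦH⟩ := hF.exists_union hH hgF.2.self_of_nhds.1 hgH.1.self_of_nhds.1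
    (eventuallyEq_of_comp_eventuallyEq hopen (hgF.2.mono fun _ h => h.2)
      (hgH.1.mono fun _ h => h.2))
  refine ⟨_, Φ, hΦ, eventually_sup.2 ⟨hgF.1.mono ?_, hgH.2.mono ?_⟩⟩
  · rintro w ⟨hw, hgw⟩
    exact ⟨Or.inl hw, hgw.trans (hΦF hw).symm⟩
  · rintro w ⟨hw, hgw⟩
    exact ⟨Or.inr hw, hgw.trans (hΦH hw).symm⟩

theorem eq_comp {H : ℝ → G} {K : Set ℝ} (hopen : 𝓝 (f x) ≤ map f (𝓝 x))
    (hxy : CommonOddPuiseuxFactor f g x y) (hK : OddPuiseuxOn H K)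
    (hgG : ∀ᶠ z in 𝓝 x, f z ∈ K ∧ g z = H (f z)) (hyK : f y ∈ K) : g y = H (f y) := by
  obtain ⟨J, F, hF, hgF⟩ := hxy
  rw [eventually_sup] at hgF
  obtain ⟨hyJ, hgy⟩ := hgF.2.self_of_nhds
  have hFG : Set.EqOn F H (J ∩ K) :=
    hF.eqOn_inter hK hgF.1.self_of_nhds.1 hgG.self_of_nhds.1
      (eventuallyEq_of_comp_eventuallyEq hopen (hgF.1.mono fun _ h => h.2)
        (hgG.mono fun _ h => h.2))
  exact hgy.trans (hFG ⟨hyJ, hyK⟩)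

theorem of_isPreconnected [CompleteSpace G] (hX : IsPreconnected X)
    (hf : ∀ x ∈ X, ContinuousAt f x) (hopen : ∀ x ∈ X, 𝓝 (f x) ≤ map f (𝓝 x))
    (hloc : ∀ x ∈ X, ∃ F, OddPuiseuxAt F (f x) ∧ ∀ᶠ y in 𝓝 x, g y = F (f y))
    (hx : x ∈ X) (hy : y ∈ X) : CommonOddPuiseuxFactor f g x y := by
  refine hX.induction₂ (CommonOddPuiseuxFactor f g) (fun x hx => ?_)
    (fun _ y _ _ hy _ hxy hyz => hxy.trans (hopen y hy) hyz) (fun _ _ _ _ h => h.symm) hx hy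
  obtain ⟨F, hF, hgF⟩ := hloc x hx
  obtain ⟨J, hJ, hFJ⟩ := hF.exists_oddPuiseuxOn
  have hx_factor : ∀ᶠ z in 𝓝 x, f z ∈ J ∧ g z = F (f z) := ((hf x hx).eventually hJ).and hgF
  filter_upwards [nhdsWithin_le_nhds hx_factor.eventually_nhds] with y hy_factor
  exact ⟨J, F, hFJ, eventually_sup.2 ⟨hx_factor, hy_factor⟩⟩

end CommonOddPuiseuxFactor

theorem exists_continuousOn_factor_of_locally {α β γ : Type*} [TopologicalSpace β]
    [TopologicalSpace γ] [Nonempty γ] {f : α → β} {g : α → γ} {X : Set α}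
    (hlocal : ∀ x ∈ X, ∃ K ∈ 𝓝 (f x), ∃ H : β → γ, ContinuousAt H (f x) ∧
      ∀ y ∈ X, f y ∈ K → g y = H (f y)) :
    ∃ F : β → γ, ContinuousOn F (f '' X) ∧ ∀ x ∈ X, g x = F (f x) := by
  choose! K hK H hH hgH using hlocal
  have hfactors : (X.domRestrict g).FactorsThrough (X.domRestrict f) := by
    rintro ⟨x, hx⟩ ⟨y, hy⟩ (hxy : f x = f y)
    change g x = g y
    rw [hgH x hx x hx (mem_of_mem_nhds (hK x hx)), hxy,
      hgH x hx y hy (hxy ▸ mem_of_mem_nhds (hK x hx))]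
  obtain ⟨F, hF⟩ := (Function.factorsThrough_iff _).1 hfactors
  have hgF : ∀ x ∈ X, g x = F (f x) := fun x hx => congrFun hF ⟨x, hx⟩
  refine ⟨F, ?_, hgF⟩
  rintro _ ⟨x, hx, rfl⟩
  have hFH : F =ᶠ[𝓝[f '' X] (f x)] H x := by
    filter_upwards [self_mem_nhdsWithin, nhdsWithin_le_nhds (hK x hx)]
    rintro _ ⟨y, hy, rfl⟩ hyK
    rw [← hgF y hy, hgH x hx y hy hyK]
  exact (hH x hx).continuousWithinAt.congr_of_eventuallyEq hFH
    ((hgF x hx).symm.trans (hgH x hx x hx (mem_of_mem_nhds (hK x hx))))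

theorem exists_continuousOn_factor_of_isPreconnected [CompleteSpace G] (hX : IsPreconnected X)
    (hf : ∀ x ∈ X, ContinuousAt f x) (hopen : ∀ x ∈ X, 𝓝 (f x) ≤ map f (𝓝 x))
    (hloc : ∀ x ∈ X, ∃ F, OddPuiseuxAt F (f x) ∧ ∀ᶠ y in 𝓝 x, g y = F (f y)) :
    ∃ F : ℝ → G, ContinuousOn F (f '' X) ∧ ∀ x ∈ X, g x = F (f x) := by
  have hlocal : ∀ x ∈ X, ∃ K ∈ 𝓝 (f x), ∃ H, ContinuousAt H (f x) ∧
      ∀ y ∈ X, f y ∈ K → g y = H (f y) := by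
    intro x hx
    obtain ⟨H, hH, hgH⟩ := hloc x hx
    obtain ⟨K, hK, hHK⟩ := hH.exists_oddPuiseuxOn
    exact ⟨K, hK, H, hH.continuousAt, fun y hy hyK =>
      (CommonOddPuiseuxFactor.of_isPreconnected hX hf hopen hloc hx hy).eq_comp (hopen x hx) hHK
        (((hf x hx).eventually hK).and hgH) hyK⟩
  exact exists_continuousOn_factor_of_locally hlocal

end Continuation

section ExtensionByDensity

theorem uIcc_mem_nhdsWithin_of_notMem {β : Type*} [TopologicalSpace β] [LinearOrder β]
    [OrderTopology β] {J : Set β} (hJ : J.OrdConnected) {a b : β} (ha : a ∉ J) (hb : b ∈ J) :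
    Set.uIcc a b ∈ 𝓝[J] a := by
  rcases (ne_of_mem_of_not_mem hb ha).lt_or_gt with hba | hab
  · filter_upwards [self_mem_nhdsWithin, nhdsWithin_le_nhds (lt_mem_nhds hba)] with t htJ hbt
    exact Set.mem_uIcc_of_ge hbt.le (le_of_not_ge fun hat => ha (hJ.out hb htJ ⟨hba.le, hat⟩))
  · filter_upwards [self_mem_nhdsWithin, nhdsWithin_le_nhds (gt_mem_nhds hab)] with t htJ htb
    exact Set.mem_uIcc_of_le (le_of_not_ge fun hta => ha (hJ.out htJ hb ⟨hta, hab.le⟩)) htb.le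

theorem eq_comp_of_mem_closure {α β γ : Type*} [TopologicalSpace α] [TopologicalSpace β]
    [TopologicalSpace γ] [T2Space γ] {f : α → β} {g : α → γ} {F : β → γ} {X : Set α} {p : α}
    (hp : p ∈ closure X) (hf : ContinuousWithinAt f X p) (hg : ContinuousWithinAt g X p)
    (hF : ContinuousWithinAt F (f '' X) (f p)) (hgF : ∀ x ∈ X, g x = F (f x)) :
    g p = F (f p) := by
  have := mem_closure_iff_nhdsWithin_neBot.1 hp
  exact tendsto_nhds_unique_of_eventuallyEq hg (hF.tendsto.comp (hf.tendsto_nhdsWithin_image))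
    (eventually_mem_nhdsWithin.mono hgF)

variable {α γ : Type*} [TopologicalSpace α] [LocallyConnectedSpace α]
  [TopologicalSpace γ] {f : α → ℝ} {g : α → γ} {F : ℝ → γ} {X Ω : Set α}

theorem tendsto_nhdsWithin_image_of_eq_comp [T2Space γ] (hΩ : IsOpen Ω) (hXΩ : X ⊆ Ω)
    (hΩX : Ω ⊆ closure X) (hX : IsPreconnected X) (hf : ContinuousOn f Ω) (hg : ContinuousOn g Ω)
    (hF : ContinuousOn F (f '' X)) (hgF : ∀ x ∈ X, g x = F (f x)) {p : α} (hp : p ∈ Ω) :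
    Tendsto F (𝓝[f '' X] (f p)) (𝓝 (g p)) := by
  have hgF_Ω : ∀ q ∈ Ω, f q ∈ f '' X → g q = F (f q) := fun q hq hfq =>
    eq_comp_of_mem_closure (hΩX hq) ((hf q hq).mono hXΩ) ((hg q hq).mono hXΩ) (hF _ hfq) hgF
  by_cases hfp : f p ∈ f '' X
  · rw [hgF_Ω p hp hfp]
    exact hF _ hfp
  intro W hW
  obtain ⟨B, hB, hB_open, hpB, hB_conn⟩ := locallyConnectedSpace_iff_subsets_isOpen_isConnected.1
    inferInstance p (Ω ∩ g ⁻¹' W)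
    (inter_mem (hΩ.mem_nhds hp) ((hg.continuousAt (hΩ.mem_nhds hp)).preimage_mem_nhds hW))
  obtain ⟨y, hyB, hyX⟩ := mem_closure_iff.1 (hΩX hp) B hB_open hpB
  have hfB : Set.uIcc (f p) (f y) ⊆ f '' B :=
    (hB_conn.isPreconnected.image f (hf.mono fun z hz => (hB hz).1)).ordConnected.uIcc_subset
      ⟨p, hpB, rfl⟩ ⟨y, hyB, rfl⟩
  rw [mem_map]
  filter_upwards [self_mem_nhdsWithin, uIcc_mem_nhdsWithin_of_notMem
    (hX.image f (hf.mono hXΩ)).ordConnected hfp ⟨y, hyX, rfl⟩] with t htX ht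
  obtain ⟨z, hzB, rfl⟩ := hfB ht
  rw [Set.mem_preimage, ← hgF_Ω z (hB hzB).1 htX]
  exact (hB hzB).2

theorem exists_continuousOn_factor_of_dense [T3Space γ] (hΩ : IsOpen Ω) (hXΩ : X ⊆ Ω)
    (hΩX : Ω ⊆ closure X) (hX : IsPreconnected X) (hf : ContinuousOn f Ω) (hg : ContinuousOn g Ω)
    (hF : ContinuousOn F (f '' X)) (hgF : ∀ x ∈ X, g x = F (f x)) :
    ∃ F' : ℝ → γ, ContinuousOn F' (f '' Ω) ∧ ∀ x ∈ Ω, g x = F' (f x) := by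
  have hlim : ∀ p ∈ Ω, Tendsto F (𝓝[f '' X] (f p)) (𝓝 (g p)) := fun p hp =>
    tendsto_nhdsWithin_image_of_eq_comp hΩ hXΩ hΩX hX hf hg hF hgF hp
  have hclosure : ∀ p ∈ Ω, f p ∈ closure (f '' X) := fun p hp =>
    ((hf p hp).mono hXΩ).mem_closure_image (hΩX hp)
  refine ⟨extendFrom (f '' X) F, continuousOn_extendFrom (Set.forall_mem_image.2 hclosure)
    (Set.forall_mem_image.2 fun p hp => ⟨g p, hlim p hp⟩), fun p hp => ?_⟩
  exact (extendFrom_eq (hclosure p hp) (hlim p hp)).symm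

end ExtensionByDensity

section CountableComplement

theorem isPreconnected_of_forall_exists_isPreconnected_inter {α : Type*} [TopologicalSpace α]
    {X Ω : Set α} (hΩ : IsPreconnected Ω) (hXΩ : X ⊆ Ω) (hΩX : Ω ⊆ closure X)
    (hloc : ∀ p ∈ Ω, ∃ U ∈ 𝓝 p, IsPreconnected (U ∩ X)) : IsPreconnected X := by
  refine isPreconnected_of_forall_constant fun φ hφ x hx y hy => ?_
  have hne : ∀ p ∈ Ω, (𝓝[X] p).NeBot := fun p hp => mem_closure_iff_nhdsWithin_neBot.1 (hΩX hp)
  obtain ⟨b, hb⟩ : ∃ b, ∀ᶠ z in 𝓝[X] x ⊔ 𝓝[X] y, φ z = b := by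
    refine hΩ.induction₂ (fun p q => ∃ b, ∀ᶠ z in 𝓝[X] p ⊔ 𝓝[X] q, φ z = b) (fun p hp => ?_) ?_
      (fun p q _ _ => by simp only [sup_comm, imp_self]) (hXΩ hx) (hXΩ hy)
    · obtain ⟨U, hU, hUX⟩ := hloc p hp
      have := hne p hp
      obtain ⟨w, hwX, hwU⟩ := nonempty_of_mem (inter_mem_nhdsWithin X hU)
      have hφw : ∀ q, U ∈ 𝓝 q → ∀ᶠ z in 𝓝[X] q, φ z = φ w := fun q hq => by
        filter_upwards [self_mem_nhdsWithin, nhdsWithin_le_nhds hq] with z hzX hzU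
        exact hUX.constant (hφ.mono Set.inter_subset_right) ⟨hzU, hzX⟩ ⟨hwU, hwX⟩
      filter_upwards [nhdsWithin_le_nhds (eventually_mem_nhds_iff.2 hU)] with q hq
      exact ⟨φ w, eventually_sup.2 ⟨hφw p hU, hφw q hq⟩⟩
    · rintro p q r - hq - ⟨b, hpq⟩ ⟨b', hqr⟩
      rw [eventually_sup] at hpq hqr
      have := hne q hq
      obtain ⟨z, hzb, hzb'⟩ := (hpq.2.and hqr.1).exists
      exact ⟨b, eventually_sup.2 ⟨hpq.1, hzb.symm.trans hzb' ▸ hqr.2⟩⟩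
  rw [eventually_sup] at hb
  exact (hb.1.self_of_nhdsWithin hx).trans (hb.2.self_of_nhdsWithin hy).symm

theorem isPreconnected_ball_sdiff_countable {E : Type*} [NormedAddCommGroup E] [NormedSpace ℝ E]
    (hE : 1 < Module.rank ℝ E) {C : Set E} (hC : C.Countable) (p : E) {ε : ℝ} (hε : 0 < ε) :
    IsPreconnected (Metric.ball p ε \ C) := by
  let e := OpenPartialHomeomorph.univBall p ε
  have he : Function.Injective e := by
    rw [← Set.injOn_univ, ← OpenPartialHomeomorph.univBall_source p ε]
    exact e.injOn
  have hrange : Set.range e = Metric.ball p ε := by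
    rw [← Set.image_univ, ← OpenPartialHomeomorph.univBall_source p ε, e.image_source_eq_target,
      OpenPartialHomeomorph.univBall_target p hε]
  rw [← hrange, ← Set.image_compl_preimage]
  exact ((hC.preimage he).isConnected_compl_of_one_lt_rank hE).isPreconnected.image _
    (OpenPartialHomeomorph.continuous_univBall p ε).continuousOn

theorem isPreconnected_sdiff_countable {E : Type*} [NormedAddCommGroup E] [NormedSpace ℝ E]
    (hE : 1 < Module.rank ℝ E) {Ω C : Set E} (hΩ_open : IsOpen Ω) (hΩ : IsPreconnected Ω)
    (hC : C.Countable) : IsPreconnected (Ω \ C) := by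
  have : Nontrivial E := rank_pos_iff_nontrivial (R := ℝ).1 (zero_lt_one.trans hE)
  refine isPreconnected_of_forall_exists_isPreconnected_inter hΩ Set.sdiff_subset
    ((hC.dense_compl ℝ).open_subset_closure_inter hΩ_open) fun p hp => ?_
  obtain ⟨ε, hε, hεΩ⟩ := Metric.isOpen_iff.1 hΩ_open p hp
  refine ⟨_, Metric.ball_mem_nhds p hε, ?_⟩
  rw [← Set.inter_sdiff_assoc, Set.inter_eq_left.2 hεΩ]
  exact isPreconnected_ball_sdiff_countable hE hC p hε

theorem countable_of_eventually_notMem {α : Type*} [TopologicalSpace α]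
    [HereditarilyLindelofSpace α] {S : Set α} (hS : ∀ x ∈ S, ∀ᶠ y in 𝓝[≠] x, y ∉ S) :
    S.Countable :=
  (HereditarilyLindelofSpace.isLindelof S).countable_of_isDiscrete <|
    isDiscrete_iff_nhdsNE.2 fun x hx => (disjoint_principal_right.2 (hS x hx)).eq_bot

end CountableComplement

section OddPoints

variable {E F : Type*} [NormedAddCommGroup E] [NormedSpace ℝ E] [NormedAddCommGroup F]
  [NormedSpace ℝ F] [CompleteSpace F] {f : E → F} {Ω : Set E}

theorem subset_closure_fderiv_ne_zero (hΩ_open : IsOpen Ω) (hΩ : IsPreconnected Ω)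
    (hf : AnalyticOnNhd ℝ f Ω) (hf_nonconst : ∃ x ∈ Ω, ∃ y ∈ Ω, f x ≠ f y) :
    Ω ⊆ closure {x ∈ Ω | fderiv ℝ f x ≠ 0} := by
  intro p hp
  by_contra hp_closure
  have hnear : ∀ᶠ z in 𝓝 p, fderiv ℝ f z = 0 := by
    filter_upwards [hΩ_open.mem_nhds hp, isClosed_closure.isOpen_compl.mem_nhds hp_closure]
      with z hzΩ hz
    by_contra hfz
    exact hz (subset_closure ⟨hzΩ, hfz⟩)
  have hzero : Set.EqOn (fderiv ℝ f) 0 Ω :=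
    hf.fderiv.eqOn_of_preconnected_of_eventuallyEq analyticOnNhd_const hΩ hp hnear
  obtain ⟨x, hx, y, hy, hxy⟩ := hf_nonconst
  exact hxy (hΩ_open.is_const_of_fderiv_eq_zero hΩ hf.differentiableOn hzero hx hy)

theorem subset_closure_odd_vanishingOrder (hΩ_open : IsOpen Ω) (hΩ : IsPreconnected Ω)
    (hf : AnalyticOnNhd ℝ f Ω) (hf_nonconst : ∃ x ∈ Ω, ∃ y ∈ Ω, f x ≠ f y) :
    Ω ⊆ closure {x ∈ Ω | Odd (vanishingOrder f x)} :=
  (subset_closure_fderiv_ne_zero hΩ_open hΩ hf hf_nonconst).trans <| closure_mono <|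
    fun _ ⟨hx, hfx⟩ => ⟨hx, by rw [vanishingOrder_eq_one_of_fderiv_ne_zero hfx]; exact odd_one⟩

end OddPoints

theorem lemma1p2_general {E G : Type*} [NormedAddCommGroup E] [NormedSpace ℝ E] [CompleteSpace E]
    [NormedAddCommGroup G] [NormedSpace ℝ G] [CompleteSpace G] {Ω : Set E} (hΩ_open : IsOpen Ω)
    (hΩ : IsPreconnected Ω) {f : E → ℝ} {g : E → G} (hf : AnalyticOnNhd ℝ f Ω)
    (hg : AnalyticOnNhd ℝ g Ω) (hf_nonconst : ∃ x ∈ Ω, ∃ y ∈ Ω, f x ≠ f y)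
    (hfg : ∀ x ∈ Ω, FDerivWedgeEqZero f g x)
    (hodd : IsPreconnected {x ∈ Ω | Odd (vanishingOrder f x)}) :
    ∃ F : ℝ → G, ContinuousOn F (f '' Ω) ∧ ∀ x ∈ Ω, g x = F (f x) := by
  obtain ⟨F, hF, hgF⟩ := exists_continuousOn_factor_of_isPreconnected hodd
    (fun x hx => (hf x hx.1).continuousAt)
    (fun x hx => nhds_le_map_of_odd_vanishingOrder (hf x hx.1) hx.2)
    (fun x hx => exists_oddPuiseuxAt_comp_eq (hf x hx.1) (hg x hx.1)
      (eventually_of_mem (hΩ_open.mem_nhds hx.1) hfg) hx.2)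
  exact exists_continuousOn_factor_of_dense hΩ_open Set.inter_subset_left
    (subset_closure_odd_vanishingOrder hΩ_open hΩ hf hf_nonconst) hodd hf.continuousOn
    hg.continuousOn hF hgF

section Plane

variable {f g : Plane → ℝ} {Ω : Set Plane}

theorem fderiv_plane_apply (f : Plane → ℝ) (x v : Plane) :
    fderiv ℝ f x v = v 0 * partialDeriv 0 f x + v 1 * partialDeriv 1 f x := by
  conv_lhs => rw [← (EuclideanSpace.basisFun (Fin 2) ℝ).sum_repr v]
  simp [partialDeriv]

theorem fderivWedgeEqZero_of_poissonBracket_eq_zero {x : Plane} (h : poissonBracket f g x = 0) :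
    FDerivWedgeEqZero f g x := fun v w => by
  simp only [fderiv_plane_apply, smul_eq_mul]
  rw [poissonBracket] at h
  linear_combination (v 0 * w 1 - v 1 * w 0) * h

theorem setOf_odd_vanishingOrder_eq (hΩ : IsPreconnected Ω) (hf : AnalyticOnNhd ℝ f Ω)
    (hf_nonconst : ∃ x ∈ Ω, ∃ y ∈ Ω, f x ≠ f y) :
    {x ∈ Ω | Odd (vanishingOrder f x)} = Ω \ evenCriticalPoints Ω f := by
  ext x
  refine and_congr_right fun hx => ?_
  have hpos : vanishingDegree f x ≠ 0 := vanishingOrder_ne_zero hΩ hf hf_nonconst hx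
  constructor
  · rintro hodd ⟨-, -, heven⟩
    exact Nat.not_even_iff_odd.2 hodd heven
  · intro hx_even
    by_contra hodd
    have heven : Even (vanishingDegree f x) := Nat.not_odd_iff_even.1 hodd
    exact hx_even ⟨hx, by grind, heven⟩

theorem isPreconnected_setOf_odd_vanishingOrder (hΩ_open : IsOpen Ω) (hΩ : IsPreconnected Ω)
    (hf : AnalyticOnNhd ℝ f Ω) (hf_nonconst : ∃ x ∈ Ω, ∃ y ∈ Ω, f x ≠ f y)
    (hisolated : ∀ x ∈ evenCriticalPoints Ω f, ∀ᶠ y in 𝓝[≠] x, y ∉ evenCriticalPoints Ω f) :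
    IsPreconnected {x ∈ Ω | Odd (vanishingOrder f x)} := by
  have hrank : 1 < Module.rank ℝ Plane := by
    rw [← Module.finrank_eq_rank, finrank_euclideanSpace_fin]
    exact Nat.one_lt_cast.2 one_lt_two
  rw [setOf_odd_vanishingOrder_eq hΩ hf hf_nonconst]
  exact isPreconnected_sdiff_countable hrank hΩ_open hΩ (countable_of_eventually_notMem hisolated)

end Plane

theorem lemma1p2 (Ω : Set Plane) (hΩ_open : IsOpen Ω) (hΩ_conn : IsConnected Ω)
    (f g : Plane → ℝ) (hf : AnalyticOnNhd ℝ f Ω) (hg : AnalyticOnNhd ℝ g Ω)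
    (hf_nonconst : ∃ x ∈ Ω, ∃ y ∈ Ω, f x ≠ f y)
    (hbracket : ∀ x ∈ Ω, poissonBracket f g x = 0)
    (hisolated : ∀ x ∈ evenCriticalPoints Ω f, ∀ᶠ y in 𝓝[≠] x, y ∉ evenCriticalPoints Ω f) :
    ∃ F : ℝ → ℝ, ContinuousOn F (f '' Ω) ∧ ∀ x ∈ Ω, g x = F (f x) :=
  lemma1p2_general hΩ_open hΩ_conn.isPreconnected hf hg hf_nonconst
    (fun x hx => fderivWedgeEqZero_of_poissonBracket_eq_zero (hbracket x hx))
    (isPreconnected_setOf_odd_vanishingOrder hΩ_open hΩ_conn.isPreconnected hf hf_nonconst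
      hisolated)
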